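/- Let $q$ be a prime power and let $V$ be an $\mathbb{F}_q$-vector space of finite dimension $n\ge 2$ with a symmetric, non-degenerate bilinear form $B$. For a subspace $C\le V$ put $C^\perp=\{v\in V\mid B(v,c)=0\text{ for all }c\in C\}$ and call $C$ self-orthogonal if $C\subseteq C^\perp$. Let $\sigma(V,B,k)$ be the number of $k$-dimensional self-orthogonal subspaces of $V$, and let the Witt index $w=w(V,B)$ be the maximal dimension of a self-orthogonal subspace (the common dimension of all maximal self-orthogonal subspaces). The form $B$ is alternating if $B(v,v)=0$ for all $v\in V$. The space $(V,B)$ is of type - (P) if $q$ and $n$ are odd; - (H) if $q$ is odd, $n$ is even and $w=n/2$; - (E) if $q$ is odd, $n$ is even and $w=n/2-1$; - (N$_1$) if $q$ is even and $n$ is odd; - (N$_{0,\mathrm a}$) if $q$ and $n$ are even and $B$ is alternating; - (N$_{0,\mathrm{na}}$) if $q$ and $n$ are even and $B$ is not alternating. Let $1\le k\le w$ and $a_k=\prod_{i=1}^k(q^i-1)$. (a) If $(V,B)$ is of type (P), (H), (E) or (N$_1$), then $$\sigma(V,B,k)=\frac{\prod_{i=1}^k (q^{n-i-w}+1)(q^{w-i+1}-1)}{a_k}.$$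 Moreover, $$\sigma(V,B,k)=\frac{\prod_{i=1}^{k}(q^{n+1-2i}-1)}{a_k}\quad\text{for type (P) and (N}_1),$$ $$\sigma(V,B,k)=\frac{(q^{n-k}+q^{n/2}-q^{n/2-k}-1)\prod_{i=1}^{k-1}(q^{n-2i}-1)}{a_k}\quad\text{for type (H)},$$ $$\sigma(V,B,k)=\frac{(q^{n-k}-q^{n/2}+q^{n/2-k}-1)\prod_{i=1}^{k-1}(q^{n-2i}-1)}{a_k}\quad\text{for type (E)}.$$ (b) If $(V,B)$ is of type (N$_{0,\mathrm a}$), then $$\sigma(V,B,k)=\frac{\prod_{i=1}^{k}(q^{n-2i+2}-1)}{a_k}.$$ (c) If $(V,B)$ is of type (N$_{0,\mathrm{na}}$), then $$\sigma(V,B,k)=\frac{(q^{n-k}-1)\prod_{i=1}^{k-1}(q^{n-2i}-1)}{a_k}.$$ -/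

import Mathlib

open Finset

namespace BilinearSpace

variable {F V : Type*} [Field F] [AddCommGroup V] [Module F V]

/-- A subspace `C` is self-orthogonal (totally isotropic) with respect to `B` if `C ⊆ C^⊥`. -/
def IsSelfOrthogonal (B : LinearMap.BilinForm F V) (C : Submodule F V) : Prop :=
  C ≤ B.orthogonal C

/-- `σ(V, B, k)`: the number of `k`-dimensional self-orthogonal subspaces of `(V, B)`. -/
noncomputable def sigma (B : LinearMap.BilinForm F V) (k : ℕ) : ℕ :=
  {C : Submodule F V | Module.finrank F C = k ∧ IsSelfOrthogonal B C}.ncard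

/-- The Witt index `w(V, B)`: the largest dimension of a self-orthogonal subspace, that is, the
common dimension of the maximal self-orthogonal subspaces. -/
noncomputable def wittIndex (B : LinearMap.BilinForm F V) : ℕ :=
  sSup {d : ℕ | ∃ C : Submodule F V, IsSelfOrthogonal B C ∧ Module.finrank F C = d}

/-- On a finite-dimensional space the supremum defining the Witt index is a maximum. -/
theorem isGreatest_wittIndex [FiniteDimensional F V] (B : LinearMap.BilinForm F V) :
    IsGreatest {d : ℕ | ∃ C : Submodule F V, IsSelfOrthogonal B C ∧ Module.finrank F C = d}
      (wittIndex B) := by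
  have hne : {d : ℕ | ∃ C : Submodule F V,
      IsSelfOrthogonal B C ∧ Module.finrank F C = d}.Nonempty :=
    ⟨0, ⊥, bot_le, finrank_bot F V⟩
  have hbdd : BddAbove {d : ℕ | ∃ C : Submodule F V,
      IsSelfOrthogonal B C ∧ Module.finrank F C = d} := by
    refine ⟨Module.finrank F V, ?_⟩
    rintro d ⟨C, -, rfl⟩
    exact Submodule.finrank_le C
  exact ⟨Nat.sSup_mem hne hbdd, fun d hd => le_csSup hbdd hd⟩

/-- Type (P), "parabolic": `q` odd and `n` odd. -/
def IsTypeP (_B : LinearMap.BilinForm F V) : Prop :=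
  Odd (Nat.card F) ∧ Odd (Module.finrank F V)

/-- Type (H), "hyperbolic": `q` odd, `n` even and `w(V, B) = n / 2`. -/
def IsTypeH (B : LinearMap.BilinForm F V) : Prop :=
  Odd (Nat.card F) ∧ Even (Module.finrank F V) ∧ wittIndex B = Module.finrank F V / 2

/-- Type (E), "elliptic": `q` odd, `n` even and `w(V, B) = n / 2 - 1`. -/
def IsTypeE (B : LinearMap.BilinForm F V) : Prop :=
  Odd (Nat.card F) ∧ Even (Module.finrank F V) ∧ wittIndex B + 1 = Module.finrank F V / 2

/-- Type (N₁): `q` even and `n` odd. -/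
def IsTypeN1 (_B : LinearMap.BilinForm F V) : Prop :=
  Even (Nat.card F) ∧ Odd (Module.finrank F V)

/-- Type (N₀,ₐ): `q` even, `n` even and `B` alternating. -/
def IsTypeN0a (B : LinearMap.BilinForm F V) : Prop :=
  Even (Nat.card F) ∧ Even (Module.finrank F V) ∧ B.IsAlt

/-- Type (N₀,ₙₐ): `q` even, `n` even and `B` not alternating. -/
def IsTypeN0na (B : LinearMap.BilinForm F V) : Prop :=
  Even (Nat.card F) ∧ Even (Module.finrank F V) ∧ ¬ B.IsAlt

end BilinearSpace

open BilinearSpace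

/-! Linearly independent `k`-tuples with self-orthogonal span are counted one vector at a time. A
`k`-dimensional subspace has `∏ (q^k - q^i) = (∏ q^i) a_k` ordered bases, with `i < k`, so dividing
by this number gives `σ`. A vector extends a self-orthogonal `C` exactly when it is an isotropic
vector of `C^⊥` outside `C`, so the problem is to count the isotropic vectors of `C^⊥`.

For odd `q`, let `M ⊇ C` be maximal self-orthogonal. A double count of isotropic translates `x + m`
with `m ∈ M` expresses the number through dimensions only (`ncard_isotropic_of_two_ne_zero`). The
case `C = 0` shows that all maximal subspaces have the same dimension. Chevalley–Warning gives `n ≤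
2w + 2`, hence `n = 2w + 1` in type (P).

For even `q` there is `u` with `B(v,v) = B(u,v)^2`, so the isotropic vectors of `C^⊥` form the
subspace `(⟨u⟩ + C)^⊥`, and besides `dim C` only whether `u ∈ C` matters. If `n` is odd, `u` is
anisotropic and never lies in `C`; if `B` is alternating, `u = 0` always does. In type (N₀,ₙₐ) `u`
is isotropic and nonzero, and both cases occur. There, with `T_k` the number of all tuples and `A_k`
the number of those whose span avoids `u`, two recursions combine to `T_{k+1} = A_k (q^{n-k-1} -
1)`. -/

namespace BilinearSpace

/-- The number of linearly independent `k`-tuples whose span satisfies `P`. -/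
noncomputable def frameCount {F V : Type*} [Field F] [AddCommGroup V] [Module F V]
    (P : Submodule F V → Prop) (k : ℕ) : ℕ :=
  Nat.card {s : Fin k → V // LinearIndependent F s ∧ P (Submodule.span F (Set.range s))}

/-! ### Ordered bases of subspaces and their extension by one vector -/

section Frames

variable {F V : Type*} [Field F] [AddCommGroup V] [Module F V]

/-- Frames are grouped by the subspace they span. -/
noncomputable def framesEquivSigma [FiniteDimensional F V] (P : Submodule F V → Prop) (k : ℕ) :
    {s : Fin k → V // LinearIndependent F s ∧ P (Submodule.span F (Set.range s))} ≃
      Σ C : {C : Submodule F V // Module.finrank F C = k ∧ P C},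
        {t : Fin k → C.1 // LinearIndependent F t} where
  toFun s := ⟨⟨Submodule.span F (Set.range s.1),
      by simpa using finrank_span_eq_card s.2.1, s.2.2⟩,
    ⟨fun i => ⟨s.1 i, Submodule.subset_span (Set.mem_range_self i)⟩,
      linearIndependent_span s.2.1⟩⟩
  invFun t := ⟨fun i => t.2.1 i, by
    have hli : LinearIndependent F (fun i => (t.2.1 i : V)) :=
      t.2.2.map' t.1.1.subtype (Submodule.ker_subtype _)
    refine ⟨hli, ?_⟩
    have hspan : Submodule.span F (Set.range fun i => (t.2.1 i : V)) = t.1.1 := by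
      apply Submodule.eq_of_le_of_finrank_eq
      · rw [Submodule.span_le]
        rintro _ ⟨i, rfl⟩
        exact (t.2.1 i).2
      · rw [finrank_span_eq_card hli, t.1.2.1, Fintype.card_fin]
    rw [hspan]
    exact t.1.2.2⟩
  left_inv s := rfl
  right_inv := by
    rintro ⟨⟨C, hC, hP⟩, ⟨t, ht⟩⟩
    have hli : LinearIndependent F (fun i => (t i : V)) :=
      ht.map' C.subtype (Submodule.ker_subtype _)
    have hspan : Submodule.span F (Set.range fun i => (t i : V)) = C := by
      apply Submodule.eq_of_le_of_finrank_eq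
      · rw [Submodule.span_le]
        rintro _ ⟨i, rfl⟩
        exact (t i).2
      · rw [finrank_span_eq_card hli, hC, Fintype.card_fin]
    -- Comparing only the underlying subspaces and vectors avoids transport along `hspan`.
    have key : ∀ x y : Σ C : {C : Submodule F V // Module.finrank F C = k ∧ P C},
        {t : Fin k → C.1 // LinearIndependent F t}, x.1.1 = y.1.1 →
        (∀ i, (x.2.1 i : V) = y.2.1 i) → x = y := by
      rintro ⟨⟨C, hC⟩, t, ht⟩ ⟨⟨D, hD⟩, t', ht'⟩ (rfl : C = D) h
      obtain rfl : t = t' := funext fun i => Subtype.ext (h i)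
      rfl
    exact key _ _ hspan fun _ => rfl

theorem frameCount_eq [Finite F] [FiniteDimensional F V] (P : Submodule F V → Prop) (k : ℕ) :
    frameCount P k = {C : Submodule F V | Module.finrank F C = k ∧ P C}.ncard *
      ∏ i ∈ range k, (Nat.card F ^ k - Nat.card F ^ i) := by
  have : Finite V := Module.finite_of_finite F
  have := Fintype.ofFinite F
  have := Fintype.ofFinite {C : Submodule F V // Module.finrank F C = k ∧ P C}
  have h (C : {C : Submodule F V // Module.finrank F C = k ∧ P C}) :
      Nat.card {t : Fin k → C.1 // LinearIndependent F t} =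
        ∏ i ∈ range k, (Nat.card F ^ k - Nat.card F ^ i) := by
    rw [card_linearIndependent C.2.1.ge, C.2.1, Finset.prod_range, Nat.card_eq_fintype_card]
  rw [frameCount, Nat.card_congr (framesEquivSigma P k), Nat.card_sigma,
    Finset.sum_congr rfl (fun C _ => h C), Finset.sum_const, smul_eq_mul, Finset.card_univ,
    ← Nat.card_eq_fintype_card]
  rfl

/-- A frame of length `k + 1` is a frame of length `k` together with an extending vector. -/
noncomputable def framesSuccEquiv (P : Submodule F V → Prop)
    (hP : ∀ C D : Submodule F V, C ≤ D → P D → P C) (k : ℕ) :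
    {s : Fin (k + 1) → V // LinearIndependent F s ∧ P (Submodule.span F (Set.range s))} ≃
      Σ s : {s : Fin k → V // LinearIndependent F s ∧ P (Submodule.span F (Set.range s))},
        {v : V // v ∉ Submodule.span F (Set.range s.1) ∧
          P (Submodule.span F {v} ⊔ Submodule.span F (Set.range s.1))} where
  toFun s := ⟨⟨Fin.tail s.1, by
      have h := s.2.1
      rw [← Fin.cons_self_tail s.1, linearIndependent_finCons] at h
      exact h.1, hP _ _ (Submodule.span_mono (by rintro _ ⟨i, rfl⟩; exact ⟨i.succ, rfl⟩)) s.2.2⟩,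
    ⟨s.1 0, by
      have h := s.2.1
      rw [← Fin.cons_self_tail s.1, linearIndependent_finCons] at h
      refine ⟨h.2, ?_⟩
      have h2 := s.2.2
      rw [← Fin.cons_self_tail s.1, Fin.range_cons, Submodule.span_insert] at h2
      exact h2⟩⟩
  invFun t := ⟨Fin.cons t.2.1 t.1.1, linearIndependent_finCons.2 ⟨t.1.2.1, t.2.2.1⟩, by
    rw [Fin.range_cons, Submodule.span_insert]
    exact t.2.2.2⟩
  left_inv s := Subtype.ext (Fin.cons_self_tail s.1)
  right_inv t := rfl

theorem frameCount_succ {k : ℕ} [Finite V] (P : Submodule F V → Prop)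
    [Fintype {s : Fin k → V // LinearIndependent F s ∧ P (Submodule.span F (Set.range s))}]
    (hP : ∀ C D : Submodule F V, C ≤ D → P D → P C) :
    frameCount P (k + 1) =
      ∑ s : {s : Fin k → V // LinearIndependent F s ∧ P (Submodule.span F (Set.range s))},
        {v : V | v ∉ Submodule.span F (Set.range s.1) ∧
          P (Submodule.span F {v} ⊔ Submodule.span F (Set.range s.1))}.ncard := by
  rw [frameCount, Nat.card_congr (framesSuccEquiv P hP k), Nat.card_sigma]
  rfl

theorem frameCount_zero [Finite F] [FiniteDimensional F V] (P : Submodule F V → Prop) (hP : P ⊥) : frameCount P 0 = 1 := by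
  rw [frameCount_eq]
  have : {C : Submodule F V | Module.finrank F C = 0 ∧ P C} = {⊥} := by
    ext C
    exact ⟨fun h => Submodule.finrank_eq_zero.1 h.1,
      fun h => ⟨Submodule.finrank_eq_zero.2 h, (show C = ⊥ from h) ▸ hP⟩⟩
  rw [this, Set.ncard_singleton, range_zero, prod_empty, mul_one]

theorem frameCount_succ_of_ncard_eq [Finite F] [FiniteDimensional F V] (P : Submodule F V → Prop)
    (hP : ∀ C D : Submodule F V, C ≤ D → P D → P C) (k : ℕ) (e : ℚ)
    (he : ∀ C : Submodule F V, Module.finrank F C = k → P C →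
      ({v : V | v ∉ C ∧ P (Submodule.span F {v} ⊔ C)}.ncard : ℚ) = e) :
    (frameCount P (k + 1) : ℚ) = frameCount P k * e := by
  classical
  have : Finite V := Module.finite_of_finite F
  have := Fintype.ofFinite
    {s : Fin k → V // LinearIndependent F s ∧ P (Submodule.span F (Set.range s))}
  rw [frameCount_succ P hP, Nat.cast_sum, Finset.sum_congr rfl (fun s _ => he _ ?_ s.2.2)]
  · simp [frameCount, Nat.card_eq_fintype_card]
  · simpa using finrank_span_eq_card s.2.1

end Frames

/-! ### Isotropic vectors and maximal self-orthogonal subspaces -/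

section Isotropic

variable {F V : Type*} [Field F] [AddCommGroup V] [Module F V] {B : LinearMap.BilinForm F V}

theorem IsSelfOrthogonal.mono {C D : Submodule F V} (h : C ≤ D) (hD : IsSelfOrthogonal B D) :
    IsSelfOrthogonal B C :=
  (h.trans hD).trans (LinearMap.BilinForm.orthogonal_le h)

theorem IsSelfOrthogonal.apply_self {C : Submodule F V} (hC : IsSelfOrthogonal B C) {v : V}
    (hv : v ∈ C) : B v v = 0 :=
  hC hv v hv

theorem isSelfOrthogonal_span_singleton_sup_iff (hsymm : B.IsSymm) {C : Submodule F V}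
    (hC : IsSelfOrthogonal B C) (v : V) :
    IsSelfOrthogonal B (Submodule.span F {v} ⊔ C) ↔ v ∈ B.orthogonal C ∧ B v v = 0 := by
  have hmem : v ∈ Submodule.span F {v} ⊔ C :=
    Submodule.mem_sup_left (Submodule.mem_span_singleton_self v)
  constructor
  · exact fun h => ⟨LinearMap.BilinForm.orthogonal_le le_sup_right (h hmem), h.apply_self hmem⟩
  · rintro ⟨hv, hvv⟩ x hx y hy
    obtain ⟨x₁, hx₁, x₂, hx₂, rfl⟩ := Submodule.mem_sup.1 hx
    obtain ⟨y₁, hy₁, y₂, hy₂, rfl⟩ := Submodule.mem_sup.1 hy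
    obtain ⟨a, rfl⟩ := Submodule.mem_span_singleton.1 hx₁
    obtain ⟨b, rfl⟩ := Submodule.mem_span_singleton.1 hy₁
    have h₁ : B x₂ y₂ = 0 := hC hy₂ x₂ hx₂
    have h₂ : B x₂ v = 0 := hv x₂ hx₂
    have h₃ : B y₂ v = 0 := hv y₂ hy₂
    change B (b • v + y₂) (a • v + x₂) = 0
    simp [hvv, h₃, hsymm.eq v x₂, h₂, hsymm.eq y₂ x₂, h₁]

/-- The vectors extending a self-orthogonal subspace to a larger one. -/
theorem ncard_extensions [Finite F] [FiniteDimensional F V] (hsymm : B.IsSymm)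
    {C : Submodule F V} (hC : IsSelfOrthogonal B C) :
    {v : V | v ∉ C ∧ IsSelfOrthogonal B (Submodule.span F {v} ⊔ C)}.ncard
      + Nat.card F ^ Module.finrank F C = {v : V | v ∈ B.orthogonal C ∧ B v v = 0}.ncard := by
  have : Finite V := Module.finite_of_finite F
  have hsub : (C : Set V) ⊆ {v : V | v ∈ B.orthogonal C ∧ B v v = 0} :=
    fun v hv => ⟨hC hv, hC.apply_self hv⟩
  have hcard : (C : Set V).ncard = Nat.card F ^ Module.finrank F C :=
    Module.natCard_eq_pow_finrank (K := F) (V := C)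
  rw [← hcard, ← Set.ncard_sdiff_add_ncard_of_subset hsub]
  congr 2
  ext v
  change _ ∧ _ ↔ _ ∧ _
  rw [isSelfOrthogonal_span_singleton_sup_iff hsymm hC]
  exact and_comm

theorem mem_of_maximal (hsymm : B.IsSymm) {M : Submodule F V}
    (hM : Maximal (IsSelfOrthogonal B) M) {v : V} (hv : v ∈ B.orthogonal M) (hvv : B v v = 0) :
    v ∈ M :=
  hM.le_of_ge ((isSelfOrthogonal_span_singleton_sup_iff hsymm hM.prop v).2 ⟨hv, hvv⟩)
    le_sup_right (Submodule.mem_sup_left (Submodule.mem_span_singleton_self v))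

theorem exists_le_maximal_isSelfOrthogonal [Finite F] [FiniteDimensional F V] {C : Submodule F V}
    (hC : IsSelfOrthogonal B C) : ∃ M, C ≤ M ∧ Maximal (IsSelfOrthogonal B) M := by
  have : Finite V := Module.finite_of_finite F
  exact Finite.exists_le_maximal hC

theorem finrank_le_wittIndex [FiniteDimensional F V] {C : Submodule F V}
    (hC : IsSelfOrthogonal B C) : Module.finrank F C ≤ wittIndex B :=
  (isGreatest_wittIndex B).2 ⟨C, hC, rfl⟩

theorem exists_maximal_finrank_eq_wittIndex [Finite F] [FiniteDimensional F V]
    (B : LinearMap.BilinForm F V) :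
    ∃ M, Maximal (IsSelfOrthogonal B) M ∧ Module.finrank F M = wittIndex B := by
  obtain ⟨C, hC, hCw⟩ := (isGreatest_wittIndex B).1
  obtain ⟨M, hCM, hM⟩ := exists_le_maximal_isSelfOrthogonal hC
  exact ⟨M, hM, le_antisymm (finrank_le_wittIndex hM.prop)
    (hCw ▸ Submodule.finrank_mono hCM)⟩

theorem finrank_add_finrank_orthogonal_eq [FiniteDimensional F V] (hnd : B.Nondegenerate)
    (C : Submodule F V) :
    Module.finrank F C + Module.finrank F (B.orthogonal C) = Module.finrank F V := by
  rw [LinearMap.BilinForm.finrank_orthogonal hnd]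
  exact Nat.add_sub_cancel' (Submodule.finrank_le C)

theorem IsSelfOrthogonal.two_mul_finrank_le [FiniteDimensional F V] (hnd : B.Nondegenerate)
    {C : Submodule F V} (hC : IsSelfOrthogonal B C) :
    2 * Module.finrank F C ≤ Module.finrank F V := by
  have h := finrank_add_finrank_orthogonal_eq hnd C
  have := Submodule.finrank_mono hC
  omega

theorem card_filter_mem_eq_pow [Finite F] [FiniteDimensional F V] [Fintype V] (C : Submodule F V)
    [DecidablePred (· ∈ C)] :
    #{v | v ∈ C} = Nat.card F ^ Module.finrank F C := by
  rw [← Module.natCard_eq_pow_finrank (K := F) (V := C), Nat.card_eq_fintype_card,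
    Fintype.card_subtype]

/-- All fibres of a nonzero functional on a finite space have the same size. -/
theorem card_fiber_mul_card [Fintype F] [DecidableEq F] [Fintype V] (M : Submodule F V)
    [DecidablePred (· ∈ M)] (f : V →ₗ[F] F) {m₀ : V} (hm₀ : m₀ ∈ M) (hf : f m₀ = 1) (c : F) :
    #{m | m ∈ M ∧ f m = c} * Fintype.card F = #{m | m ∈ M} := by
  have h (d : F) : #{m | m ∈ M ∧ f m = d} = #{m | m ∈ M ∧ f m = c} := by
    refine card_bij' (fun m _ => m + (c - d) • m₀) (fun m _ => m - (c - d) • m₀) ?_ ?_ ?_ ?_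
    · intro m hm
      simp only [mem_filter, mem_univ, true_and] at hm ⊢
      exact ⟨M.add_mem hm.1 (M.smul_mem _ hm₀), by simp [hm.2, hf]⟩
    · intro m hm
      simp only [mem_filter, mem_univ, true_and] at hm ⊢
      exact ⟨M.sub_mem hm.1 (M.smul_mem _ hm₀), by simp [hm.2, hf]⟩
    · intro m _
      simp
    · intro m _
      simp
  rw [card_eq_sum_card_fiberwise (f := f) (s := {m | m ∈ M}) (t := univ) (fun _ _ => mem_univ _)]
  simp only [filter_filter, h, sum_const, card_univ, smul_eq_mul]
  exact mul_comm _ _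

/-- The number of isotropic vectors orthogonal to a self-orthogonal subspace `C`,
in terms of a maximal self-orthogonal subspace containing `C`. -/
theorem ncard_isotropic_of_two_ne_zero [Finite F] [FiniteDimensional F V] (h2 : (2 : F) ≠ 0)
    (hsymm : B.IsSymm) {C M : Submodule F V} (hCM : C ≤ M)
    (hM : Maximal (IsSelfOrthogonal B) M) :
    Nat.card F * {v : V | v ∈ B.orthogonal C ∧ B v v = 0}.ncard
        + Nat.card F ^ Module.finrank F (B.orthogonal M) =
      Nat.card F * Nat.card F ^ Module.finrank F M
        + Nat.card F ^ Module.finrank F (B.orthogonal C) := by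
  classical
  have : Finite V := Module.finite_of_finite F
  have := Fintype.ofFinite V
  have := Fintype.ofFinite F
  have hMC : B.orthogonal M ≤ B.orthogonal C := LinearMap.BilinForm.orthogonal_le hCM
  have hMM : M ≤ B.orthogonal M := hM.prop
  set X : Finset V := {x | x ∈ B.orthogonal C ∧ x ∉ B.orthogonal M} with hX
  set Y : Finset V := {x | (x ∈ B.orthogonal C ∧ x ∉ B.orthogonal M) ∧ B x x = 0} with hY
  have hadd {x m : V} (hm : m ∈ M) : B (x + m) (x + m) = B x x + 2 * B x m := by
    have := hM.prop.apply_self hm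
    simp only [map_add, LinearMap.add_apply, hsymm.eq m x, this]
    ring
  -- Pairs `(x, m)` with `x + m` isotropic are counted in two ways. For fixed `x ∉ M^⊥` the
  -- condition reads `B x m = -(B x x) / 2`, one fibre of a functional that is nonzero on `M`.
  have h₁ : ∀ x ∈ X, #{m | m ∈ M ∧ B (x + m) (x + m) = 0} * Fintype.card F = #{m | m ∈ M} := by
    intro x hx
    simp only [hX, mem_filter, mem_univ, true_and] at hx
    obtain ⟨m, hm, hne⟩ : ∃ m ∈ M, B m x ≠ 0 := by
      by_contra! h
      exact hx.2 h
    have hm₀ : B x ((B m x)⁻¹ • m) = 1 := by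
      rw [map_smul, smul_eq_mul, hsymm.eq x m, inv_mul_cancel₀ hne]
    rw [← card_fiber_mul_card M (B x) (M.smul_mem _ hm) hm₀ (-(B x x) / 2)]
    congr 2
    ext y
    simp only [mem_filter, mem_univ, true_and]
    refine and_congr_right fun hy => ?_
    rw [hadd hy, eq_div_iff h2, eq_neg_iff_add_eq_zero, mul_comm (2 : F), add_comm]
  -- For fixed `m`, translation by `m ∈ M ≤ M^⊥` permutes `X`, so the count does not depend on `m`.
  have h₂ : ∀ m ∈ ({m | m ∈ M} : Finset V), #{x ∈ X | B (x + m) (x + m) = 0} = #Y := by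
    intro m hm
    simp only [mem_filter, mem_univ, true_and] at hm
    refine card_bij' (fun x _ => x + m) (fun x _ => x - m) ?_ ?_ ?_ ?_
    · intro x hx
      simp only [hX, hY, mem_filter, mem_univ, true_and] at hx ⊢
      exact ⟨⟨Submodule.add_mem _ hx.1.1 (hMC (hMM hm)),
        fun h => hx.1.2 ((Submodule.add_mem_iff_left _ (hMM hm)).1 h)⟩, hx.2⟩
    · intro x hx
      simp only [hX, hY, mem_filter, mem_univ, true_and] at hx ⊢
      exact ⟨⟨Submodule.sub_mem _ hx.1.1 (hMC (hMM hm)),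
        fun h => hx.1.2 ((Submodule.sub_mem_iff_left _ (hMM hm)).1 h)⟩, by simpa using hx.2⟩
    · intro x _
      simp
    · intro x _
      simp
  have hdc := sum_card_bipartiteAbove_eq_sum_card_bipartiteBelow (s := X)
    (t := ({m | m ∈ M} : Finset V)) (fun x m => B (x + m) (x + m) = 0)
  simp only [bipartiteAbove, bipartiteBelow, filter_filter] at hdc
  rw [sum_congr rfl h₂, sum_const, smul_eq_mul] at hdc
  have hpos : 0 < #{m | m ∈ M} := card_pos.2 ⟨0, by simp⟩
  have hXY : Fintype.card F * #Y = #X := by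
    refine Nat.eq_of_mul_eq_mul_left hpos ?_
    rw [mul_left_comm, ← hdc, mul_sum, mul_comm #{m | m ∈ M} #X, ← smul_eq_mul (#X),
      ← sum_const]
    exact sum_congr rfl fun x hx => by rw [mul_comm, h₁ x hx]
  have hXc : #X + #{v | v ∈ B.orthogonal M} = #{v | v ∈ B.orthogonal C} := by
    rw [← card_filter_add_card_filter_not (s := {v | v ∈ B.orthogonal C})
      (fun v => v ∉ B.orthogonal M), filter_filter, filter_filter]
    congr 2
    ext v
    simp only [mem_filter, mem_univ, true_and, not_not]
    exact ⟨fun h => ⟨hMC h, h⟩, fun h => h.2⟩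
  -- Inside `M^⊥`, maximality leaves no isotropic vectors but those of `M`.
  have hS : {v : V | v ∈ B.orthogonal C ∧ B v v = 0}.ncard = #Y + #{m | m ∈ M} := by
    have : {v : V | v ∈ B.orthogonal C ∧ B v v = 0} =
        (({v | v ∈ B.orthogonal C ∧ B v v = 0} : Finset V) : Set V) := by
      ext v; simp
    rw [this, Set.ncard_coe_finset,
      ← card_filter_add_card_filter_not (s := {v | v ∈ B.orthogonal C ∧ B v v = 0})
      (fun v => v ∉ B.orthogonal M), filter_filter, filter_filter]
    congr 2
    · ext v
      simp only [hY, mem_filter, mem_univ, true_and]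
      tauto
    · ext v
      simp only [mem_filter, mem_univ, true_and, not_not]
      exact ⟨fun h => mem_of_maximal hsymm hM h.2 h.1.2,
        fun h => ⟨⟨hMC (hMM h), hM.prop.apply_self h⟩, hMM h⟩⟩
  rw [card_filter_mem_eq_pow, card_filter_mem_eq_pow] at hXc
  rw [hS, ← hXc, ← hXY, card_filter_mem_eq_pow, Nat.card_eq_fintype_card]
  ring

theorem finrank_span_singleton_sup [FiniteDimensional F V] {C : Submodule F V} {u : V} (hu : u ∉ C) :
    Module.finrank F ↥(Submodule.span F {u} ⊔ C) = Module.finrank F C + 1 := by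
  have h0 : u ≠ 0 := fun h => hu (h ▸ C.zero_mem)
  have hd : Submodule.span F {u} ⊓ C = ⊥ :=
    ((Submodule.disjoint_span_singleton' h0).2 hu).symm.eq_bot
  have h := Submodule.finrank_sup_add_finrank_inf_eq (Submodule.span F {u}) C
  rw [hd, finrank_bot, finrank_span_singleton h0] at h
  omega

theorem ncard_coe_eq_pow_finrank [FiniteDimensional F V] (C : Submodule F V) :
    {v : V | v ∈ C}.ncard = Nat.card F ^ Module.finrank F C :=
  Module.natCard_eq_pow_finrank (K := F) (V := C)

/-- Isotropic vectors orthogonal to `C` form a subspace in characteristic two. -/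
theorem mem_orthogonal_span_singleton_sup_iff {u : V} (hu : ∀ v, B v v = B u v ^ 2)
    (C : Submodule F V) (v : V) :
    v ∈ B.orthogonal (Submodule.span F {u} ⊔ C) ↔ v ∈ B.orthogonal C ∧ B v v = 0 := by
  rw [hu, sq_eq_zero_iff]
  constructor
  · exact fun h => ⟨LinearMap.BilinForm.orthogonal_le le_sup_right h,
      h u (Submodule.mem_sup_left (Submodule.mem_span_singleton_self u))⟩
  · rintro ⟨hv, hvu⟩ x hx
    obtain ⟨x₁, hx₁, x₂, hx₂, rfl⟩ := Submodule.mem_sup.1 hx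
    obtain ⟨a, rfl⟩ := Submodule.mem_span_singleton.1 hx₁
    have h₂ : B x₂ v = 0 := hv x₂ hx₂
    change B (a • u + x₂) v = 0
    simp [hvu, h₂]

theorem mem_orthogonal_of_apply_self_eq_sq (hsymm : B.IsSymm) {u : V}
    (hu : ∀ v, B v v = B u v ^ 2) {C : Submodule F V} (hC : IsSelfOrthogonal B C) :
    u ∈ B.orthogonal C := by
  intro v hv
  have := hu v
  rw [hC.apply_self hv, eq_comm, sq_eq_zero_iff, hsymm.eq] at this
  exact this

theorem isSelfOrthogonal_bot : IsSelfOrthogonal B ⊥ := bot_le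

/-- The isotropic vectors of `M^⊥` form `(⟨u⟩ + M)^⊥`, and by maximality they are exactly `M`. The
parity of `n` therefore decides whether `u ∈ M`. -/
theorem finrank_maximal_of_even_card [FiniteDimensional F V] (hsymm : B.IsSymm) (hnd : B.Nondegenerate) {u : V}
    (hu : ∀ v, B v v = B u v ^ 2) {M : Submodule F V} (hM : Maximal (IsSelfOrthogonal B) M) :
    Module.finrank F ↥(Submodule.span F {u} ⊔ M) + Module.finrank F M = Module.finrank F V := by
  have h : M = B.orthogonal (Submodule.span F {u} ⊔ M) := by
    ext v
    rw [mem_orthogonal_span_singleton_sup_iff hu]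
    exact ⟨fun hv => ⟨hM.prop hv, hM.prop.apply_self hv⟩,
      fun hv => mem_of_maximal hsymm hM hv.1 hv.2⟩
  have hd := finrank_add_finrank_orthogonal_eq hnd (Submodule.span F {u} ⊔ M)
  rwa [← h] at hd

end Isotropic

/-! ### Numbers of extensions, and the Witt index -/

section Extensions

variable {F V : Type*} [Field F] [Finite F] [AddCommGroup V] [Module F V]
  [FiniteDimensional F V] {B : LinearMap.BilinForm F V}

theorem two_ne_zero_of_odd_card (hF : Odd (Nat.card F)) : (2 : F) ≠ 0 := by
  have := Fintype.ofFinite F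
  intro h
  have hchar : ringChar F = 2 :=
    CharP.ringChar_of_prime_eq_zero Nat.prime_two (by exact_mod_cast h)
  have := FiniteField.even_card_iff_char_two.1 hchar
  rw [Nat.card_eq_fintype_card, Nat.odd_iff] at hF
  omega

theorem charP_two_of_even_card (hF : Even (Nat.card F)) : CharP F 2 := by
  have := Fintype.ofFinite F
  rw [Nat.card_eq_fintype_card, Nat.even_iff] at hF
  exact ringChar.of_eq (FiniteField.even_card_iff_char_two.2 hF)

/-- In odd characteristic, all maximal self-orthogonal subspaces have the same dimension. -/
theorem finrank_eq_of_maximal (h2 : (2 : F) ≠ 0) (hsymm : B.IsSymm) (hnd : B.Nondegenerate)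
    {M N : Submodule F V} (hM : Maximal (IsSelfOrthogonal B) M)
    (hN : Maximal (IsSelfOrthogonal B) N) : Module.finrank F M = Module.finrank F N := by
  have key : ∀ {M N : Submodule F V}, Maximal (IsSelfOrthogonal B) M →
      Maximal (IsSelfOrthogonal B) N → ¬ Module.finrank F M < Module.finrank F N := by
    intro M N hM hN hlt
    -- With `C = 0` both identities involve the same number of isotropic vectors, so `q^(d+1) -
    -- q^(n-d)` agrees for the two dimensions `d`; it is strictly increasing in `d`.
    have h₁ := ncard_isotropic_of_two_ne_zero h2 hsymm bot_le hM
    have h₂ := ncard_isotropic_of_two_ne_zero h2 hsymm bot_le hN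
    have d₁ := finrank_add_finrank_orthogonal_eq hnd M
    have d₂ := finrank_add_finrank_orthogonal_eq hnd N
    have hq : 1 < Nat.card F := Finite.one_lt_card
    have l₁ : Nat.card F ^ Module.finrank F (B.orthogonal N) ≤
        Nat.card F ^ Module.finrank F (B.orthogonal M) :=
      Nat.pow_le_pow_right hq.le (by omega)
    have l₂ : Nat.card F * Nat.card F ^ Module.finrank F M <
        Nat.card F * Nat.card F ^ Module.finrank F N :=
      Nat.mul_lt_mul_of_pos_left (Nat.pow_lt_pow_right hq hlt) (by omega)
    omega
  have := key hM hN
  have := key hN hM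
  omega

theorem ncard_extensions_of_two_ne_zero (h2 : (2 : F) ≠ 0) (hsymm : B.IsSymm)
    (hnd : B.Nondegenerate) {C : Submodule F V} (hC : IsSelfOrthogonal B C)
    (hlt : Module.finrank F C < wittIndex B) :
    ({v : V | v ∉ C ∧ IsSelfOrthogonal B (Submodule.span F {v} ⊔ C)}.ncard : ℚ) =
      (Nat.card F : ℚ) ^ Module.finrank F C *
        (((Nat.card F : ℚ) ^ (Module.finrank F V - (Module.finrank F C + 1) - wittIndex B) + 1) *
          ((Nat.card F : ℚ) ^ (wittIndex B - Module.finrank F C) - 1)) := by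
  obtain ⟨N, hN, hNw⟩ := exists_maximal_finrank_eq_wittIndex B
  obtain ⟨M, hCM, hM⟩ := exists_le_maximal_isSelfOrthogonal hC
  have hMw := (finrank_eq_of_maximal h2 hsymm hnd hM hN).trans hNw
  have hz := ncard_isotropic_of_two_ne_zero h2 hsymm hCM hM
  have he := ncard_extensions hsymm hC
  have hM2 := hM.prop.two_mul_finrank_le hnd
  have hq : (Nat.card F : ℚ) ≠ 0 := by
    exact_mod_cast (Nat.card_pos (α := F)).ne'
  rw [LinearMap.BilinForm.finrank_orthogonal hnd, LinearMap.BilinForm.finrank_orthogonal hnd, hMw,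
    ← he] at hz
  generalize Set.ncard _ = e at hz ⊢
  rw [hMw] at hM2
  -- Writing `dim C = i`, `w = i + j + 1` and `n = 2w + d` removes every truncated subtraction.
  obtain ⟨j, hj⟩ := Nat.exists_eq_add_of_lt hlt
  obtain ⟨d, hd⟩ := Nat.exists_eq_add_of_le hM2
  rw [hd, hj] at hz ⊢
  generalize Module.finrank F C = i at *
  rw [show 2 * (i + j + 1) + d - (i + j + 1) = i + j + 1 + d by omega,
    show 2 * (i + j + 1) + d - i = i + 2 * j + 2 + d by omega] at hz
  rw [show 2 * (i + j + 1) + d - (i + 1) - (i + j + 1) = j + d by omega,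
    show i + j + 1 - i = j + 1 by omega]
  have hz' : (Nat.card F : ℚ) * (e + (Nat.card F : ℚ) ^ i) + (Nat.card F : ℚ) ^ (i + j + 1 + d) =
      Nat.card F * (Nat.card F : ℚ) ^ (i + j + 1) + (Nat.card F : ℚ) ^ (i + 2 * j + 2 + d) := by
    exact_mod_cast hz
  apply mul_left_cancel₀ hq
  linear_combination hz'

/-- In characteristic two, `v ↦ B v v` is the square of a linear functional. -/
theorem exists_apply_self_eq_sq (hF : Even (Nat.card F)) (hsymm : B.IsSymm)
    (hnd : B.Nondegenerate) : ∃ u : V, ∀ v, B v v = B u v ^ 2 := by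
  have := charP_two_of_even_card hF
  -- The square root of `B v v` is additive because the cross terms `2 B x y` vanish; nondegeneracy
  -- then represents it by a vector `u`.
  let φ : V →ₗ[F] F :=
    { toFun := fun v => (frobeniusEquiv F 2).symm (B v v)
      map_add' := fun x y => by
        rw [← map_add]
        congr 1
        simp only [map_add, LinearMap.add_apply]
        rw [hsymm.eq y x]
        linear_combination (CharTwo.add_self_eq_zero (B x y))
      map_smul' := fun c x => by
        have : B (c • x) (c • x) = (frobeniusEquiv F 2 c) * B x x := by
          simp [frobeniusEquiv_apply, frobenius_def]
          ring
        rw [this, map_mul, RingEquiv.symm_apply_apply]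
        rfl }
  refine ⟨(B.toDual hnd).symm φ, fun v => ?_⟩
  rw [LinearMap.BilinForm.apply_toDual_symm_apply]
  exact (frobeniusEquiv_symm_pow_p F 2 (B v v)).symm

theorem ncard_extensions_of_even_card (hsymm : B.IsSymm)
    (hnd : B.Nondegenerate) {u : V} (hu : ∀ v, B v v = B u v ^ 2) {C : Submodule F V}
    (hC : IsSelfOrthogonal B C) :
    ({v : V | v ∉ C ∧ IsSelfOrthogonal B (Submodule.span F {v} ⊔ C)}.ncard : ℚ) =
      (Nat.card F : ℚ) ^
        (Module.finrank F V - Module.finrank F ↥(Submodule.span F {u} ⊔ C)) -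
      (Nat.card F : ℚ) ^ Module.finrank F C := by
  have he := ncard_extensions hsymm hC
  simp_rw [← mem_orthogonal_span_singleton_sup_iff hu C] at he
  rw [ncard_coe_eq_pow_finrank, LinearMap.BilinForm.finrank_orthogonal hnd] at he
  rw [eq_sub_iff_add_eq]
  exact_mod_cast he

/-- For a maximal `M`, `u ∈ M` would make `n = 2 dim M` even. Since `u` always lies in `M^⊥`, it can
stay outside `M` only by being anisotropic. -/
theorem apply_self_ne_zero_of_odd_finrank (hsymm : B.IsSymm) (hnd : B.Nondegenerate) {u : V}
    (hu : ∀ v, B v v = B u v ^ 2) (hn : Odd (Module.finrank F V)) :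
    B u u ≠ 0 ∧ Module.finrank F V = 2 * wittIndex B + 1 := by
  obtain ⟨M, hM, hMw⟩ := exists_maximal_finrank_eq_wittIndex B
  have hd := finrank_maximal_of_even_card hsymm hnd hu hM
  have huM : u ∉ M := by
    intro h
    rw [sup_eq_right.2 ((Submodule.span_singleton_le_iff_mem u M).2 h), ← two_mul] at hd
    exact Nat.not_even_iff_odd.2 hn ⟨_, hd.symm.trans (two_mul _)⟩
  rw [finrank_span_singleton_sup huM] at hd
  exact ⟨fun h => huM (mem_of_maximal hsymm hM
    (mem_orthogonal_of_apply_self_eq_sq hsymm hu hM.prop) h), by omega⟩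

/-- An anisotropic `u` would lie outside a maximal `M` and give `n = 2 dim M + 1`. -/
theorem apply_self_eq_zero_of_even_finrank (hsymm : B.IsSymm) (hnd : B.Nondegenerate) {u : V}
    (hu : ∀ v, B v v = B u v ^ 2) (hn : Even (Module.finrank F V)) : B u u = 0 := by
  obtain ⟨M, hM, -⟩ := exists_maximal_finrank_eq_wittIndex B
  have hd := finrank_maximal_of_even_card hsymm hnd hu hM
  by_contra huu
  have huM : u ∉ M := fun h => huu (hM.prop.apply_self h)
  rw [finrank_span_singleton_sup huM] at hd
  exact Nat.not_even_iff_odd.2 ⟨Module.finrank F M, by omega⟩ hn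

open MvPolynomial in
/-- An anisotropic subspace over a finite field has dimension at most two. -/
theorem finrank_le_two_of_anisotropic (N : Submodule F V)
    (hN : ∀ v ∈ N, B v v = 0 → v = 0) : Module.finrank F N ≤ 2 := by
  classical
  by_contra! hlt
  have := Fintype.ofFinite F
  let b := Module.finBasis F N
  let f : MvPolynomial (Fin (Module.finrank F N)) F :=
    ∑ i, ∑ j, C (B (b i) (b j)) * (X i * X j)
  have hf : f.totalDegree ≤ 2 := by
    refine totalDegree_finsetSum_le fun i _ => totalDegree_finsetSum_le fun j _ => ?_
    refine (totalDegree_mul _ _).trans ?_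
    rw [totalDegree_C, zero_add]
    exact (totalDegree_mul _ _).trans (by simp)
  have heval (x : Fin (Module.finrank F N) → F) :
      eval x f = B (∑ i, x i • b i : N) (∑ i, x i • b i : N) := by
    simp only [f, map_sum, map_mul, eval_C, eval_X, Submodule.coe_sum, Submodule.coe_smul,
      LinearMap.sum_apply, map_smul, LinearMap.smul_apply, smul_eq_mul, mul_sum]
    rw [sum_comm]
    exact sum_congr rfl fun _ _ => sum_congr rfl fun _ _ => by ring
  have hone : Fintype.card {x : Fin (Module.finrank F N) → F // eval x f = 0} = 1 := by
    refine Fintype.card_eq_one_iff.2 ⟨⟨0, by rw [heval]; simp⟩, ?_⟩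
    rintro ⟨x, hx⟩
    rw [heval] at hx
    have h0 : ∑ i, x i • b i = 0 := by
      exact_mod_cast hN _ (Submodule.coe_mem _) hx
    exact Subtype.ext (funext fun i =>
      Fintype.linearIndependent_iff.1 b.linearIndependent x h0 i)
  -- Chevalley–Warning: a quadratic form in at least three variables has a number of zeros divisible
  -- by the characteristic, but anisotropy leaves only the zero vector.
  have hdvd := char_dvd_card_solutions (ringChar F) (f := f) (by
    rw [Fintype.card_fin]
    omega)
  rw [hone, Nat.dvd_one] at hdvd
  exact CharP.ringChar_ne_one hdvd

/-- If `N` is a complement of a maximal `M` of dimension `w`, then `N ∩ M^⊥` is anisotropic and has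
dimension at least `n - 2w`. -/
theorem finrank_le_two_mul_wittIndex_add_two (hsymm : B.IsSymm) (hnd : B.Nondegenerate) :
    Module.finrank F V ≤ 2 * wittIndex B + 2 := by
  obtain ⟨M, hM, hMw⟩ := exists_maximal_finrank_eq_wittIndex B
  obtain ⟨N, hN⟩ := Submodule.exists_isCompl M
  have h₁ := finrank_le_two_of_anisotropic (B := B) (N ⊓ B.orthogonal M) fun v hv hvv =>
    (Submodule.disjoint_def.1 hN.disjoint) v (mem_of_maximal hsymm hM hv.2 hvv) hv.1
  have h₂ := Submodule.finrank_sup_add_finrank_inf_eq N (B.orthogonal M)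
  have h₃ := Submodule.finrank_le (N ⊔ B.orthogonal M)
  have h₄ := Submodule.finrank_add_eq_of_isCompl hN
  have h₅ := finrank_add_finrank_orthogonal_eq hnd M
  omega

end Extensions

theorem prod_Icc_one_eq_prod_range {R : Type*} [CommMonoid R] (f : ℕ → R) (k : ℕ) :
    ∏ i ∈ Icc 1 k, f i = ∏ i ∈ range k, f (i + 1) := by
  rw [range_eq_Ico, prod_Ico_add' f 0 k 1]
  rfl

/-! ### From tuples to `σ`, by parity of `q` and `n` -/

section Counting

variable {F V : Type*} [Field F] [Finite F] [AddCommGroup V] [Module F V]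
  [FiniteDimensional F V] {B : LinearMap.BilinForm F V}

theorem prod_pow_sub_one_ne_zero (k : ℕ) : ∏ i ∈ Icc 1 k, ((Nat.card F : ℚ) ^ i - 1) ≠ 0 := by
  refine prod_ne_zero_iff.2 fun i hi => ?_
  have hq : (1 : ℚ) < Nat.card F := by exact_mod_cast Finite.one_lt_card (α := F)
  exact (sub_pos.2 (one_lt_pow₀ hq (by have := (mem_Icc.1 hi).1; omega))).ne'

/-- Factoring `q^k - q^i = q^i (q^(k-i) - 1)` and reversing the product turns the number of ordered
bases into `(∏ q^i) a_k`; the powers of `q` cancel. -/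
theorem sigma_eq_div_of_frameCount {k : ℕ} {G : ℚ}
    (h : (frameCount (IsSelfOrthogonal B) k : ℚ) = (∏ i ∈ range k, (Nat.card F : ℚ) ^ i) * G) :
    (sigma B k : ℚ) = G / ∏ i ∈ Icc 1 k, ((Nat.card F : ℚ) ^ i - 1) := by
  have hq : 1 ≤ Nat.card F := Nat.card_pos
  have hq0 : (Nat.card F : ℚ) ≠ 0 := by exact_mod_cast (Nat.card_pos (α := F)).ne'
  rw [eq_div_iff (prod_pow_sub_one_ne_zero k)]
  have hp : ∏ i ∈ range k, (Nat.card F : ℚ) ^ i ≠ 0 :=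
    prod_ne_zero_iff.2 fun i _ => pow_ne_zero i hq0
  apply mul_left_cancel₀ hp
  rw [← h, frameCount_eq, Nat.cast_mul, Nat.cast_prod, prod_Icc_one_eq_prod_range,
    ← prod_range_reflect (fun i => (Nat.card F : ℚ) ^ (i + 1) - 1), mul_left_comm,
    ← prod_mul_distrib]
  change (sigma B k : ℚ) * _ = (sigma B k : ℚ) * _
  congr 1
  refine prod_congr rfl fun i hi => ?_
  have hi := mem_range.1 hi
  rw [Nat.cast_sub (Nat.pow_le_pow_right hq hi.le), mul_sub, ← pow_add, mul_one,
    show i + (k - 1 - i + 1) = k by omega]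
  push_cast
  rfl

theorem sigma_eq_prod_div {k : ℕ} (g : ℕ → ℚ)
    (hg : ∀ C : Submodule F V, Module.finrank F C < k → IsSelfOrthogonal B C →
      ({v : V | v ∉ C ∧ IsSelfOrthogonal B (Submodule.span F {v} ⊔ C)}.ncard : ℚ) =
        (Nat.card F : ℚ) ^ Module.finrank F C * g (Module.finrank F C)) :
    (sigma B k : ℚ) = (∏ i ∈ range k, g i) / ∏ i ∈ Icc 1 k, ((Nat.card F : ℚ) ^ i - 1) := by
  apply sigma_eq_div_of_frameCount
  rw [← prod_mul_distrib]
  induction k with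
  | zero => simp [frameCount_zero _ isSelfOrthogonal_bot]
  | succ k ih =>
    rw [frameCount_succ_of_ncard_eq _ (fun _ _ => IsSelfOrthogonal.mono) k
      ((Nat.card F : ℚ) ^ k * g k), ih (fun C hC => hg C (by omega)), prod_range_succ]
    rintro C rfl hC
    exact hg C (by omega) hC

theorem sigma_of_two_ne_zero (h2 : (2 : F) ≠ 0) (hsymm : B.IsSymm) (hnd : B.Nondegenerate)
    {k : ℕ} (hk : k ≤ wittIndex B) :
    (sigma B k : ℚ) =
      (∏ i ∈ Icc 1 k, ((Nat.card F : ℚ) ^ (Module.finrank F V - i - wittIndex B) + 1) *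
        ((Nat.card F : ℚ) ^ (wittIndex B - i + 1) - 1)) /
        ∏ i ∈ Icc 1 k, ((Nat.card F : ℚ) ^ i - 1) := by
  rw [sigma_eq_prod_div (fun i =>
    ((Nat.card F : ℚ) ^ (Module.finrank F V - (i + 1) - wittIndex B) + 1) *
      ((Nat.card F : ℚ) ^ (wittIndex B - i) - 1)) fun C hC hCo =>
    ncard_extensions_of_two_ne_zero h2 hsymm hnd hCo (by omega)]
  congr 1
  rw [prod_Icc_one_eq_prod_range]
  refine prod_congr rfl fun i hi => ?_
  have := mem_range.1 hi
  rw [show wittIndex B - (i + 1) + 1 = wittIndex B - i by omega]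

theorem sigma_of_odd_finrank_of_even_card (hsymm : B.IsSymm) (hnd : B.Nondegenerate)
    (hF : Even (Nat.card F)) (hn : Odd (Module.finrank F V)) {k : ℕ}
    (hk : k ≤ wittIndex B) :
    (sigma B k : ℚ) =
      (∏ i ∈ Icc 1 k, ((Nat.card F : ℚ) ^ (Module.finrank F V - i - wittIndex B) + 1) *
        ((Nat.card F : ℚ) ^ (wittIndex B - i + 1) - 1)) /
        ∏ i ∈ Icc 1 k, ((Nat.card F : ℚ) ^ i - 1) := by
  obtain ⟨u, hu⟩ := exists_apply_self_eq_sq hF hsymm hnd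
  obtain ⟨huu, hnw⟩ := apply_self_ne_zero_of_odd_finrank hsymm hnd hu hn
  rw [sigma_eq_prod_div (fun i =>
    ((Nat.card F : ℚ) ^ (Module.finrank F V - (i + 1) - wittIndex B) + 1) *
      ((Nat.card F : ℚ) ^ (wittIndex B - i) - 1)) ?_]
  · congr 1
    rw [prod_Icc_one_eq_prod_range]
    refine prod_congr rfl fun i hi => ?_
    have := mem_range.1 hi
    rw [show wittIndex B - (i + 1) + 1 = wittIndex B - i by omega]
  · intro C hCk hC
    have huC : u ∉ C := fun h => huu (hC.apply_self h)
    rw [ncard_extensions_of_even_card hsymm hnd hu hC, finrank_span_singleton_sup huC, hnw]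
    generalize Module.finrank F C = i at *
    obtain ⟨j, hj⟩ := Nat.exists_eq_add_of_lt (hCk.trans_le hk)
    rw [hj, show 2 * (i + j + 1) + 1 - (i + 1) = i + 2 * j + 2 by omega,
      show i + 2 * j + 2 - (i + j + 1) = j + 1 by omega,
      show i + j + 1 - i = j + 1 by omega]
    ring

theorem sigma_of_isAlt (hsymm : B.IsSymm) (hnd : B.Nondegenerate) (halt : B.IsAlt) {k : ℕ}
    (hk : k ≤ wittIndex B) :
    (sigma B k : ℚ) = (∏ i ∈ Icc 1 k, ((Nat.card F : ℚ) ^ (Module.finrank F V - 2 * i + 2) - 1)) /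
        ∏ i ∈ Icc 1 k, ((Nat.card F : ℚ) ^ i - 1) := by
  obtain ⟨M, hM, hMw⟩ := exists_maximal_finrank_eq_wittIndex B
  have h2w := hM.prop.two_mul_finrank_le hnd
  rw [sigma_eq_prod_div (fun i => (Nat.card F : ℚ) ^ (Module.finrank F V - 2 * i) - 1) ?_]
  · congr 1
    rw [prod_Icc_one_eq_prod_range]
    refine prod_congr rfl fun i hi => ?_
    have := mem_range.1 hi
    rw [show Module.finrank F V - 2 * (i + 1) + 2 = Module.finrank F V - 2 * i by omega]
  · intro C hCk hC
    -- For an alternating form `u = 0` represents `B v v`, in any characteristic.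
    rw [ncard_extensions_of_even_card (u := 0) hsymm hnd (fun v => by simp [halt v]) hC,
      Submodule.span_zero_singleton, bot_sup_eq, mul_sub, ← pow_add, mul_one]
    congr 2
    omega

/-- By the exchange property, adjoining `v ∉ C` captures `u` exactly when `v ∈ ⟨u⟩ + C`. The
admissible `v` thus form `(⟨u⟩ + C)^⊥` minus `⟨u⟩ + C`, which it contains because `u` is isotropic.
-/
theorem ncard_extensions_avoiding (hsymm : B.IsSymm) (hnd : B.Nondegenerate) {u : V}
    (hu : ∀ v, B v v = B u v ^ 2) (huu : B u u = 0) {C : Submodule F V}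
    (hC : IsSelfOrthogonal B C) (huC : u ∉ C) :
    ({v : V | v ∉ C ∧ (IsSelfOrthogonal B (Submodule.span F {v} ⊔ C) ∧
      u ∉ Submodule.span F {v} ⊔ C)}.ncard : ℚ) =
      (Nat.card F : ℚ) ^ (Module.finrank F V - (Module.finrank F C + 1)) -
        (Nat.card F : ℚ) ^ (Module.finrank F C + 1) := by
  have : Finite V := Module.finite_of_finite F
  have hD : IsSelfOrthogonal B (Submodule.span F {u} ⊔ C) :=
    (isSelfOrthogonal_span_singleton_sup_iff hsymm hC u).2
      ⟨mem_orthogonal_of_apply_self_eq_sq hsymm hu hC, huu⟩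
  have hset : {v : V | v ∉ C ∧ (IsSelfOrthogonal B (Submodule.span F {v} ⊔ C) ∧
      u ∉ Submodule.span F {v} ⊔ C)} =
      {v : V | v ∈ B.orthogonal (Submodule.span F {u} ⊔ C)} \
        {v : V | v ∈ Submodule.span F {u} ⊔ C} := by
    ext v
    change v ∉ C ∧ _ ∧ _ ↔ _ ∈ B.orthogonal _ ∧ ¬ v ∈ Submodule.span F {u} ⊔ C
    rw [isSelfOrthogonal_span_singleton_sup_iff hsymm hC,
      mem_orthogonal_span_singleton_sup_iff hu]
    have hex {x y : V} (hx : x ∉ C) (h : x ∈ Submodule.span F {y} ⊔ C) :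
        y ∈ Submodule.span F {x} ⊔ C := by
      rw [← Submodule.span_eq C, ← Submodule.span_insert] at h ⊢
      exact mem_span_insert_exchange h (by rwa [Submodule.span_eq])
    constructor
    · rintro ⟨hv, hiso, huv⟩
      exact ⟨hiso, fun h => huv (hex hv h)⟩
    · rintro ⟨hiso, hvu⟩
      exact ⟨fun h => hvu (Submodule.mem_sup_right h), hiso, fun h => hvu (hex huC h)⟩
  have hcard := Set.ncard_sdiff_add_ncard_of_subset
    (show {v : V | v ∈ Submodule.span F {u} ⊔ C} ⊆
      {v : V | v ∈ B.orthogonal (Submodule.span F {u} ⊔ C)} from hD)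
  rw [← hset, ncard_coe_eq_pow_finrank, ncard_coe_eq_pow_finrank,
    LinearMap.BilinForm.finrank_orthogonal hnd, finrank_span_singleton_sup huC] at hcard
  rw [eq_sub_iff_add_eq]
  exact_mod_cast hcard

theorem frameCount_avoiding_succ (hsymm : B.IsSymm) (hnd : B.Nondegenerate) {u : V}
    (hu : ∀ v, B v v = B u v ^ 2) (huu : B u u = 0) (k : ℕ) :
    (frameCount (fun C => IsSelfOrthogonal B C ∧ u ∉ C) (k + 1) : ℚ) =
      frameCount (fun C => IsSelfOrthogonal B C ∧ u ∉ C) k *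
        ((Nat.card F : ℚ) ^ (Module.finrank F V - (k + 1)) - (Nat.card F : ℚ) ^ (k + 1)) := by
  refine frameCount_succ_of_ncard_eq _
    (fun C D h hD => ⟨hD.1.mono h, fun huC => hD.2 (h huC)⟩) k _ ?_
  rintro C rfl hC
  exact ncard_extensions_avoiding hsymm hnd hu huu hC.1 hC.2

/-- A span containing `u` has `q^(n-k) - q^k` extensions, one avoiding `u` has `q^(n-k-1) - q^k`.
The second term corrects for the latter. -/
theorem frameCount_isSelfOrthogonal_succ (hsymm : B.IsSymm) (hnd : B.Nondegenerate) {u : V}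
    (hu : ∀ v, B v v = B u v ^ 2) (k : ℕ) :
    (frameCount (IsSelfOrthogonal B) (k + 1) : ℚ) =
      frameCount (IsSelfOrthogonal B) k *
        ((Nat.card F : ℚ) ^ (Module.finrank F V - k) - (Nat.card F : ℚ) ^ k) -
      frameCount (fun C => IsSelfOrthogonal B C ∧ u ∉ C) k *
        ((Nat.card F : ℚ) ^ (Module.finrank F V - k) -
          (Nat.card F : ℚ) ^ (Module.finrank F V - (k + 1))) := by
  classical
  have : Finite V := Module.finite_of_finite F
  have := Fintype.ofFinite {s : Fin k → V // LinearIndependent F s ∧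
    IsSelfOrthogonal B (Submodule.span F (Set.range s))}
  rw [frameCount_succ _ (fun _ _ => IsSelfOrthogonal.mono), Nat.cast_sum]
  have hs (s : {s : Fin k → V // LinearIndependent F s ∧
      IsSelfOrthogonal B (Submodule.span F (Set.range s))}) :
      ({v : V | v ∉ Submodule.span F (Set.range s.1) ∧ IsSelfOrthogonal B
          (Submodule.span F {v} ⊔ Submodule.span F (Set.range s.1))}.ncard : ℚ) =
        ((Nat.card F : ℚ) ^ (Module.finrank F V - k) - (Nat.card F : ℚ) ^ k) -
        (if u ∉ Submodule.span F (Set.range s.1) then 1 else 0) *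
          ((Nat.card F : ℚ) ^ (Module.finrank F V - k) -
            (Nat.card F : ℚ) ^ (Module.finrank F V - (k + 1))) := by
    have hk : Module.finrank F (Submodule.span F (Set.range s.1)) = k := by
      simpa using finrank_span_eq_card s.2.1
    rw [ncard_extensions_of_even_card hsymm hnd hu s.2.2]
    split_ifs with h
    · rw [sup_eq_right.2 ((Submodule.span_singleton_le_iff_mem u _).2 h), hk]
      ring
    · rw [finrank_span_singleton_sup h, hk]
      ring
  rw [sum_congr rfl (fun s _ => hs s), sum_sub_distrib, ← sum_mul, sum_const, sum_boole,
    nsmul_eq_mul]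
  congr 3
  · rw [frameCount, Nat.card_eq_fintype_card, Finset.card_univ]
  · rw [frameCount, ← Fintype.card_subtype, ← Nat.card_eq_fintype_card]
    refine Nat.card_congr ((Equiv.subtypeSubtypeEquivSubtypeInter
      (fun s : Fin k → V => LinearIndependent F s ∧
        IsSelfOrthogonal B (Submodule.span F (Set.range s)))
      (fun s => u ∉ Submodule.span F (Set.range s))).trans
      (Equiv.subtypeEquivRight fun s => ?_))
    exact and_assoc

theorem sigma_of_not_isAlt (hsymm : B.IsSymm) (hnd : B.Nondegenerate) (hF : Even (Nat.card F))
    (hn : Even (Module.finrank F V)) (halt : ¬ B.IsAlt) {k : ℕ} (hk1 : 1 ≤ k)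
    (hk : k ≤ wittIndex B) :
    (sigma B k : ℚ) = (((Nat.card F : ℚ) ^ (Module.finrank F V - k) - 1) *
      ∏ i ∈ Icc 1 (k - 1), ((Nat.card F : ℚ) ^ (Module.finrank F V - 2 * i) - 1)) /
        ∏ i ∈ Icc 1 k, ((Nat.card F : ℚ) ^ i - 1) := by
  obtain ⟨M, hM, hMw⟩ := exists_maximal_finrank_eq_wittIndex B
  have h2w := hM.prop.two_mul_finrank_le hnd
  obtain ⟨u, hu⟩ := exists_apply_self_eq_sq hF hsymm hnd
  have huu := apply_self_eq_zero_of_even_finrank hsymm hnd hu hn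
  have hu0 : u ≠ 0 := by
    rintro rfl
    exact halt fun v => by simp [hu v]
  have hA := frameCount_avoiding_succ hsymm hnd hu huu
  have hT := frameCount_isSelfOrthogonal_succ hsymm hnd hu
  have hA0 : frameCount (fun C => IsSelfOrthogonal B C ∧ u ∉ C) 0 = 1 :=
    frameCount_zero _ ⟨isSelfOrthogonal_bot, fun h => hu0 ((Submodule.mem_bot F).1 h)⟩
  have hT0 : frameCount (IsSelfOrthogonal B) 0 = 1 := frameCount_zero _ isSelfOrthogonal_bot
  -- The induction closes because `(q^(n-j-1) - 1) - (q^(n-j-1) - q^(n-j-2)) = q^(n-j-2) - 1`.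
  have hTA (j : ℕ) : (frameCount (IsSelfOrthogonal B) (j + 1) : ℚ) =
      frameCount (fun C => IsSelfOrthogonal B C ∧ u ∉ C) j *
        ((Nat.card F : ℚ) ^ (Module.finrank F V - (j + 1)) - 1) := by
    induction j with
    | zero =>
      rw [hT, hA0, hT0]
      push_cast
      ring
    | succ j ih =>
      rw [hT, ih, hA]
      ring
  have hAprod (j : ℕ) (hj : j ≤ wittIndex B) :
      (frameCount (fun C => IsSelfOrthogonal B C ∧ u ∉ C) j : ℚ) =
        (∏ i ∈ range j, (Nat.card F : ℚ) ^ (i + 1)) *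
          ∏ i ∈ range j, ((Nat.card F : ℚ) ^ (Module.finrank F V - 2 * (i + 1)) - 1) := by
    rw [← prod_mul_distrib]
    induction j with
    | zero => simp [hA0]
    | succ j ih =>
      -- Here `j + 1 ≤ w` and `2w ≤ n` allow `q^(j+1)` to be factored out.
      rw [hA, ih (by omega), prod_range_succ,
        show Module.finrank F V - (j + 1) = j + 1 + (Module.finrank F V - 2 * (j + 1)) by omega]
      ring
  obtain ⟨j, rfl⟩ := Nat.exists_eq_add_of_le' hk1
  apply sigma_eq_div_of_frameCount
  rw [hTA, hAprod j (by omega), prod_range_succ', Nat.add_sub_cancel, prod_Icc_one_eq_prod_range]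
  ring

end Counting

/-! ### Regrouping the products -/

section Identities

/-- The product for hyperbolic spaces, with `w` the Witt index. -/
theorem prod_hyperbolic (q : ℚ) (w k : ℕ) (hk1 : 1 ≤ k) (hk : k ≤ w) :
    ∏ i ∈ Icc 1 k, (q ^ (2 * w - i - w) + 1) * (q ^ (w - i + 1) - 1) =
      (q ^ (2 * w - k) + q ^ w - q ^ (w - k) - 1) *
        ∏ i ∈ Icc 1 (k - 1), (q ^ (2 * w - 2 * i) - 1) := by
  -- The leading factor is `(q^(w-k) + 1)(q^w - 1)`; the remaining factors pair up as `(q^(w-i) +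
  -- 1)(q^(w-i) - 1)`.
  induction k, hk1 using Nat.le_induction with
  | base =>
    obtain ⟨v, rfl⟩ := Nat.exists_eq_add_of_le' hk
    simp only [Icc_self, prod_singleton, Nat.sub_self, Nat.add_sub_cancel]
    rw [show 2 * (v + 1) - 1 - (v + 1) = v by omega, show 2 * (v + 1) - 1 = 2 * v + 1 by omega]
    simp
    ring
  | succ k hk1 ih =>
    obtain ⟨k, rfl⟩ := Nat.exists_eq_add_of_le' hk1
    rw [prod_Icc_succ_top (by omega), ih (by omega), Nat.add_sub_cancel, Nat.add_sub_cancel,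
      prod_Icc_succ_top (by omega)]
    obtain ⟨v, rfl⟩ := Nat.exists_eq_add_of_le' hk
    rw [show 2 * (v + (k + 1 + 1)) - (k + 1) = 2 * v + k + 3 by omega,
      show v + (k + 1 + 1) - (k + 1) = v + 1 by omega,
      show 2 * (v + (k + 1 + 1)) - (k + 1 + 1) - (v + (k + 1 + 1)) = v by omega,
      show 2 * (v + (k + 1 + 1)) - (k + 1 + 1) = 2 * v + k + 2 by omega,
      show v + (k + 1 + 1) - (k + 1 + 1) = v by omega,
      show 2 * (v + (k + 1 + 1)) - 2 * (k + 1) = 2 * v + 2 by omega]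
    ring

/-- The product for elliptic spaces, with `w` the Witt index. -/
theorem prod_elliptic (q : ℚ) (w k : ℕ) (hk1 : 1 ≤ k) (hk : k ≤ w) :
    ∏ i ∈ Icc 1 k, (q ^ (2 * (w + 1) - i - w) + 1) * (q ^ (w - i + 1) - 1) =
      (q ^ (2 * (w + 1) - k) - q ^ (w + 1) + q ^ (w + 1 - k) - 1) *
        ∏ i ∈ Icc 1 (k - 1), (q ^ (2 * (w + 1) - 2 * i) - 1) := by
  -- With `m = w + 1` the leading factor is `(q^m + 1)(q^(m-k) - 1)`, and the rest pairs up as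
  -- `(q^(m-i) + 1)(q^(m-i) - 1)`.
  induction k, hk1 using Nat.le_induction with
  | base =>
    obtain ⟨v, rfl⟩ := Nat.exists_eq_add_of_le' hk
    simp only [Icc_self, prod_singleton, Nat.sub_self, Nat.add_sub_cancel]
    rw [show 2 * (v + 1 + 1) - 1 - (v + 1) = v + 2 by omega,
      show 2 * (v + 1 + 1) - 1 = 2 * v + 3 by omega]
    simp
    ring
  | succ k hk1 ih =>
    obtain ⟨k, rfl⟩ := Nat.exists_eq_add_of_le' hk1
    rw [prod_Icc_succ_top (by omega), ih (by omega), Nat.add_sub_cancel, Nat.add_sub_cancel,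
      prod_Icc_succ_top (by omega)]
    obtain ⟨v, rfl⟩ := Nat.exists_eq_add_of_le' hk
    rw [show 2 * (v + (k + 1 + 1) + 1) - (k + 1) = 2 * v + k + 5 by omega,
      show v + (k + 1 + 1) + 1 - (k + 1) = v + 2 by omega,
      show 2 * (v + (k + 1 + 1) + 1) - (k + 1 + 1) - (v + (k + 1 + 1)) = v + 2 by omega,
      show 2 * (v + (k + 1 + 1) + 1) - (k + 1 + 1) = 2 * v + k + 4 by omega,
      show v + (k + 1 + 1) + 1 - (k + 1 + 1) = v + 1 by omega,
      show v + (k + 1 + 1) - (k + 1 + 1) = v by omega,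
      show 2 * (v + (k + 1 + 1) + 1) - 2 * (k + 1) = 2 * v + 4 by omega]
    ring

/-- The product for odd-dimensional spaces, with `w` the Witt index. -/
theorem prod_parabolic (q : ℚ) (w k : ℕ) (hk : k ≤ w) :
    ∏ i ∈ Icc 1 k, (q ^ (2 * w + 1 - i - w) + 1) * (q ^ (w - i + 1) - 1) =
      ∏ i ∈ Icc 1 k, (q ^ (2 * w + 1 + 1 - 2 * i) - 1) := by
  refine prod_congr rfl fun i hi => ?_
  have := mem_Icc.1 hi
  rw [show 2 * w + 1 - i - w = w - i + 1 by omega,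
    show 2 * w + 1 + 1 - 2 * i = (w - i + 1) + (w - i + 1) by omega, pow_add]
  ring

end Identities

end BilinearSpace

theorem mainTheorem6 {F V : Type*} [Field F] [Finite F] [AddCommGroup V] [Module F V]
    [FiniteDimensional F V] (B : LinearMap.BilinForm F V) (hsymm : B.IsSymm)
    (hnd : B.Nondegenerate) (q n w k : ℕ) (hq : q = Nat.card F)
    (hn : n = Module.finrank F V) (hn2 : 2 ≤ n) (hw : w = wittIndex B)
    (hk1 : 1 ≤ k) (hkw : k ≤ w) (a : ℚ) (ha : a = ∏ i ∈ Icc 1 k, ((q : ℚ) ^ i - 1)) :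
    -- part (a), first expression
    ((IsTypeP B ∨ IsTypeH B ∨ IsTypeE B ∨ IsTypeN1 B) →
      (sigma B k : ℚ) =
        (∏ i ∈ Icc 1 k, ((q : ℚ) ^ (n - i - w) + 1) * ((q : ℚ) ^ (w - i + 1) - 1)) / a) ∧
    -- part (a), second expression
    ((IsTypeP B ∨ IsTypeN1 B) →
      (sigma B k : ℚ) = (∏ i ∈ Icc 1 k, ((q : ℚ) ^ (n + 1 - 2 * i) - 1)) / a) ∧
    (IsTypeH B →
      (sigma B k : ℚ) =
        (((q : ℚ) ^ (n - k) + (q : ℚ) ^ (n / 2) - (q : ℚ) ^ (n / 2 - k) - 1) *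
          ∏ i ∈ Icc 1 (k - 1), ((q : ℚ) ^ (n - 2 * i) - 1)) / a) ∧
    (IsTypeE B →
      (sigma B k : ℚ) =
        (((q : ℚ) ^ (n - k) - (q : ℚ) ^ (n / 2) + (q : ℚ) ^ (n / 2 - k) - 1) *
          ∏ i ∈ Icc 1 (k - 1), ((q : ℚ) ^ (n - 2 * i) - 1)) / a) ∧
    -- part (b)
    (IsTypeN0a B →
      (sigma B k : ℚ) = (∏ i ∈ Icc 1 k, ((q : ℚ) ^ (n - 2 * i + 2) - 1)) / a) ∧
    -- part (c)
    (IsTypeN0na B →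
      (sigma B k : ℚ) =
        (((q : ℚ) ^ (n - k) - 1) *
          ∏ i ∈ Icc 1 (k - 1), ((q : ℚ) ^ (n - 2 * i) - 1)) / a) := by
  have hgen : (IsTypeP B ∨ IsTypeH B ∨ IsTypeE B ∨ IsTypeN1 B) →
      (sigma B k : ℚ) =
        (∏ i ∈ Icc 1 k, ((q : ℚ) ^ (n - i - w) + 1) * ((q : ℚ) ^ (w - i + 1) - 1)) / a := by
    subst hq hn hw ha
    rintro (h | h | h | h)
    · exact sigma_of_two_ne_zero (two_ne_zero_of_odd_card h.1) hsymm hnd hkw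
    · exact sigma_of_two_ne_zero (two_ne_zero_of_odd_card h.1) hsymm hnd hkw
    · exact sigma_of_two_ne_zero (two_ne_zero_of_odd_card h.1) hsymm hnd hkw
    · exact sigma_of_odd_finrank_of_even_card hsymm hnd h.1 h.2 hkw
  refine ⟨hgen, fun h => ?_, fun h => ?_, fun h => ?_, fun h => ?_, fun h => ?_⟩
  · have hnw : n = 2 * w + 1 := by
      rcases h with h | h
      -- The bounds `2w ≤ n ≤ 2w + 2` leave one odd value.
      · obtain ⟨M, hM, hMw⟩ := exists_maximal_finrank_eq_wittIndex B
        have h₁ := hM.prop.two_mul_finrank_le hnd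
        have h₂ := finrank_le_two_mul_wittIndex_add_two hsymm hnd
        obtain ⟨m, hm⟩ := h.2
        omega
      · obtain ⟨u, hu⟩ := exists_apply_self_eq_sq h.1 hsymm hnd
        rw [hn, hw]
        exact (apply_self_ne_zero_of_odd_finrank hsymm hnd hu h.2).2
    rw [hgen (h.imp_right fun h => Or.inr (Or.inr h)), hnw, prod_parabolic _ _ _ hkw]
  · have hnw : n = 2 * w := by
      obtain ⟨m, hm⟩ := h.2.1
      have := h.2.2
      omega
    rw [hgen (Or.inr (Or.inl h)), hnw, prod_hyperbolic _ _ _ hk1 hkw,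
      Nat.mul_div_cancel_left _ two_pos]
  · have hnw : n = 2 * (w + 1) := by
      obtain ⟨m, hm⟩ := h.2.1
      have := h.2.2
      omega
    rw [hgen (Or.inr (Or.inr (Or.inl h))), hnw, prod_elliptic _ _ _ hk1 hkw,
      Nat.mul_div_cancel_left _ two_pos]
  · subst hq hn hw ha
    exact sigma_of_isAlt hsymm hnd h.2.2 hkw
  · subst hq hn hw ha
    exact sigma_of_not_isAlt hsymm hnd h.1 h.2.1 h.2.2 hk1 hkw
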